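/- Let $\phi:\mathbb{R}^2\to\mathbb{R}$ be a nonnegative, twice continuously differentiable, strictly convex function whose Hessian $H(\phi)$ satisfies one of the following conditions: (i) $H(\phi)(y_0)=0$ for some $y_0\in\mathbb{R}^2$; or (ii) there is a sequence $(y_n)\subset\mathbb{R}^2$ with $|y_n|\to\infty$ and $H(\phi)(y_n)\to0$ as $n\to\infty$. Let $\sigma$ be the projection measure on the surface $\{(y,|y|^2+\phi(y)):y\in\mathbb{R}^2\}\subset\mathbb{R}^3$, i.e. $\int g\,d\sigma=\int_{\mathbb{R}^2}g(y,|y|^2+\phi(y))\,dy$. For $f\in L^2(\mathbb{R}^2)$ (complex-valued), $\|f\sigma*f\sigma\|_{L^2(\mathbb{R}^3)}$ denotes the $L^2$ norm of the Lebesgue density of the convolution measure $f\sigma*f\sigma$ on $\mathbb{R}^3$ (set to $+\infty$ if there is no locally integrable density). Put $$\mathcal{R}_\phi=\sup_{0\ne f\in L^2(\mathbb{R}^2)}\frac{\|f\sigma*f\sigma\|_{L^2(\mathbb{R}^3)}^{1/2}}{\|f\|_{L^2(\mathbb{R}^2)}}.$$ A sequence $(f_n)\subset L^2(\mathbb{R}^2)$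 is called extremizing if $\|f_n\|_{L^2}\le1$ for all $n$ and $\|f_n\sigma*f_n\sigma\|_{L^2(\mathbb{R}^3)}\to\mathcal{R}_\phi^2$ as $n\to\infty$. A sequence $(f_n)\subset L^2(\mathbb{R}^2)$ satisfies the splitting condition if there exists $\alpha\in(0,1)$ such that for every $\varepsilon>0$ there exist $r>0$, $n_0\ge1$, and sequences $(y_n)\subset\mathbb{R}^2$, $(r_n)\subset\mathbb{R}$ with $r_n\to\infty$, such that the functions $g_{n,1}=f_n\mathbf{1}_{B_r(y_n)}$ and $g_{n,2}=f_n\mathbf{1}_{\mathbb{R}^2\setminus B_{r_n}(y_n)}$ satisfy $$\|f_n-(g_{n,1}+g_{n,2})\|_{L^2}^2\le\varepsilon,\qquad\bigl|\|g_{n,1}\|_{L^2}^2-\alpha\bigr|\le\varepsilon,\qquad\bigl|\|g_{n,2}\|_{L^2}^2-(1-\alpha)\bigr|\le\varepsilon$$ for every $n\ge n_0$. Then no extremizing sequence $(f_n)$ satisfies the splitting condition. -/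

import Mathlib

open MeasureTheory Filter Topology
open scoped ENNReal

namespace PerturbedParaboloid

noncomputable section

/-- The Euclidean plane. -/
abbrev Plane : Type := EuclideanSpace ℝ (Fin 2)

/-- Complex-valued `L²(ℝ²)`. -/
abbrev L2Plane : Type := Lp ℂ 2 (volume : Measure Plane)

/-- The function `ψ = |·|² + φ` whose graph is the surface `Σ_φ`. -/
def psi (φ : Plane → ℝ) (y : Plane) : ℝ := ‖y‖ ^ 2 + φ y

/-- Projection measure on `Σ_φ = {(y, |y|² + φ(y))} ⊆ ℝ² × ℝ`: the measure `σ` with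
`∫ g(y,t) dσ(y,t) = ∫ g(y, |y|² + φ(y)) dy`. -/
def projMeasure (φ : Plane → ℝ) : Measure (Plane × ℝ) :=
  (volume : Measure Plane).map (fun y => (y, psi φ y))

/-- `F` is the Lebesgue density of the (locally finite, complex) measure `fσ ∗ gσ` on `ℝ² × ℝ`:
for all bounded Borel sets `E`,
`∫_E F = (fσ ∗ gσ)(E) = ∬ 1_E(p + q) f(p) g(q) dσ(p) dσ(q)`,
where functions on the plane are read as functions on the surface by projection. -/
def IsConvDensity (φ : Plane → ℝ) (f g : Plane → ℂ) (F : Plane × ℝ → ℂ) : Prop :=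
  LocallyIntegrable F volume ∧
    ∀ E : Set (Plane × ℝ), MeasurableSet E → Bornology.IsBounded E →
      ∫ x in E, F x =
        ∫ pq : (Plane × ℝ) × (Plane × ℝ),
          E.indicator (fun _ => f pq.1.1 * g pq.2.1) (pq.1 + pq.2)
          ∂((projMeasure φ).prod (projMeasure φ))

/-- The norm `‖fσ ∗ gσ‖_{L²(ℝ³)} ∈ [0, ∞]`. Densities are unique up to null sets, so the infimum
is over one value; it is `∞` if `fσ ∗ gσ` is not given by a locally integrable function. -/
def convNorm (φ : Plane → ℝ) (f g : Plane → ℂ) : ℝ≥0∞ :=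
  ⨅ (F : Plane × ℝ → ℂ) (_ : IsConvDensity φ f g F), eLpNorm F 2 volume

/-- The optimal constant `R_φ = sup_{0 ≠ f ∈ L²} ‖fσ ∗ fσ‖_{L²}^{1/2} / ‖f‖_{L²}`. -/
def optConst (φ : Plane → ℝ) : ℝ≥0∞ :=
  ⨆ (f : L2Plane) (_ : f ≠ 0), convNorm φ f f ^ (1 / 2 : ℝ) / ‖f‖ₑ

/-- Extremizing sequences for `‖fσ ∗ fσ‖_{L²(ℝ³)} ≤ R_φ² ‖f‖²_{L²(ℝ²)}`. -/
def IsExtremizingSeq (φ : Plane → ℝ) (f : ℕ → L2Plane) : Prop :=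
  (∀ n, ‖f n‖ ≤ 1) ∧
    Tendsto (fun n => convNorm φ (f n) (f n)) atTop (𝓝 (optConst φ ^ 2))

/-- The squared `L²(ℝ²)` norm. -/
def normSq (u : Plane → ℂ) : ℝ := (eLpNorm u 2 volume).toReal ^ 2

/-- The splitting condition: there is `α ∈ (0,1)` such that for every `ε > 0` there are a radius
`r`, centers `yₙ` and radii `rₙ → ∞` such that, up to `ε`, eventually mass `α` of `fₙ` lies in the
ball `B_r(yₙ)`, mass `1 - α` lies outside `B_{rₙ}(yₙ)`, and nothing remains. -/
def SplittingCondition (f : ℕ → L2Plane) : Prop :=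
  ∃ α : ℝ, 0 < α ∧ α < 1 ∧ ∀ ε : ℝ, 0 < ε →
    ∃ (r : ℝ) (n₀ : ℕ) (y : ℕ → Plane) (R : ℕ → ℝ), 0 < r ∧ Tendsto R atTop atTop ∧
      ∀ n, n₀ ≤ n →
        let g₁ : Plane → ℂ := (Metric.ball (y n) r).indicator (f n)
        let g₂ : Plane → ℂ := (Metric.ball (y n) (R n))ᶜ.indicator (f n)
        normSq (fun x => f n x - (g₁ x + g₂ x)) ≤ ε ∧
          |normSq g₁ - α| ≤ ε ∧ |normSq g₂ - (1 - α)| ≤ ε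

/-- The Hessian of `φ` at `y`, as a bilinear form. -/
def hessian (φ : Plane → ℝ) (y : Plane) : Plane →L[ℝ] Plane →L[ℝ] ℝ :=
  fderiv ℝ (fderiv ℝ φ) y

end

end PerturbedParaboloid

namespace PerturbedParaboloid

open Set

/-! The convolution `fσ ∗ fσ` is the push-forward of `f ⊗ f` under S(y, y') = (y + y', ψ(y) +
ψ(y')), where ψ = |·|² + φ. Put y = ξ/2 + z, y' = ξ/2 - z and use polar coordinates in z. By
convexity of φ, the radial derivative of ψ(y) + ψ(y') is at least 4ρ, so S carries Lebesgue measure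
to at most 2π · 1/4 = π/2 times Lebesgue measure (`map_surfaceSum_le`). Duality turns such a measure
bound C into the L² bound √C for the push-forward (`norm_pushforward_le`).

If y lies in a ball and y' far from it, only a thin sector of directions of z occurs, so the
constant tends to 0 (`map_surfaceSum_separated_le`). Up to small errors, a split function therefore
contributes only its two diagonal blocks. These have disjoint supports, so together their L² norm is
√(α² + (1 - α)²), giving at most √(π/2) · √(α² + (1 - α)²) < √(π/2) in the limit.

On the other hand R_φ² ≥ √(π/2) (`sqrt_half_pi_le_optConst_sq`): where the Hessian is nearly zero, ψ
minus its affine part is nearly |y - c|², and concentrating exponentials of this difference come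
arbitrarily close to √(π/2). The two bounds are incompatible. -/

/-! ### Level sets of functions with large radial derivative, in polar coordinates -/

/-- Since ρ ≤ k'(ρ)/4 and k is injective, the change of variables τ = k(ρ) bounds the polar weight ρ
dρ by dτ/4. -/
theorem lintegral_radial_le {k k' : ℝ → ℝ} (hk : ∀ ρ, 0 < ρ → HasDerivAt k (k' ρ) ρ)
    (hk' : ∀ ρ, 0 < ρ → 4 * ρ ≤ k' ρ) (E : Set ℝ) (hE : MeasurableSet E) :
    ∫⁻ ρ in Ioi (0 : ℝ), ENNReal.ofReal ρ * E.indicator 1 (k ρ) ≤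
      ENNReal.ofReal (1 / 4) * volume E := by
  have hinj : InjOn k (Ioi 0) := by
    apply StrictMonoOn.injOn
    apply strictMonoOn_of_deriv_pos (convex_Ioi 0)
    · exact fun x hx => (hk x hx).continuousAt.continuousWithinAt
    · intro x hx
      rw [interior_Ioi] at hx
      rw [(hk x hx).deriv]
      have := hk' x hx
      have hx' : (0 : ℝ) < x := hx
      linarith
  have key := lintegral_image_eq_lintegral_abs_deriv_mul measurableSet_Ioi
    (fun x hx => (hk x hx).hasDerivWithinAt) hinj (E.indicator 1)
  calc ∫⁻ ρ in Ioi (0 : ℝ), ENNReal.ofReal ρ * E.indicator 1 (k ρ)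
      ≤ ∫⁻ ρ in Ioi (0 : ℝ), ENNReal.ofReal (1 / 4) *
          (ENNReal.ofReal |k' ρ| * E.indicator 1 (k ρ)) := by
        refine setLIntegral_mono' measurableSet_Ioi fun ρ hρ => ?_
        rw [← mul_assoc, ← ENNReal.ofReal_mul (by norm_num)]
        gcongr
        have := hk' ρ hρ
        have := le_abs_self (k' ρ)
        linarith
    _ = ENNReal.ofReal (1 / 4) * ∫⁻ x in k '' Ioi 0, E.indicator 1 x := by
        rw [lintegral_const_mul' _ _ ENNReal.ofReal_ne_top, key]
    _ ≤ ENNReal.ofReal (1 / 4) * volume E := by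
        gcongr
        calc _ ≤ ∫⁻ x, E.indicator 1 x := setLIntegral_le_lintegral _ _
          _ = volume E := by rw [lintegral_indicator_one hE]

theorem volume_sector_preimage_le {h : ℂ → ℝ} (hm : Measurable h) {h' : ℝ → ℝ → ℝ}
    (hd : ∀ θ ρ, 0 < ρ → HasDerivAt (fun ρ => h (Complex.polarCoord.symm (ρ, θ))) (h' θ ρ) ρ)
    (hd' : ∀ θ ρ, 0 < ρ → 4 * ρ ≤ h' θ ρ)
    {A : Set ℂ} (hA : MeasurableSet A) {Θ : Set ℝ} (hΘ : MeasurableSet Θ)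
    (hAΘ : ∀ θ ρ, 0 < ρ → Complex.polarCoord.symm (ρ, θ) ∈ A → θ ∈ Θ)
    {E : Set ℝ} (hE : MeasurableSet E) :
    volume (A ∩ h ⁻¹' E) ≤ volume (Θ ∩ Ioo (-Real.pi) Real.pi) *
      (ENNReal.ofReal (1 / 4) * volume E) := by
  have hs : Measurable (fun p : ℝ × ℝ => Complex.polarCoord.symm p) := by
    have : (fun p : ℝ × ℝ => Complex.polarCoord.symm p) =
        fun p : ℝ × ℝ => (p.1 : ℂ) * (Real.cos p.2 + Real.sin p.2 * Complex.I) := by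
      ext p; rw [Complex.polarCoord_symm_apply]
    rw [this]
    fun_prop
  have hAE : MeasurableSet (A ∩ h ⁻¹' E) := hA.inter (hm hE)
  rw [← lintegral_indicator_one hAE, ← Complex.lintegral_comp_polarCoord_symm, polarCoord_target,
    Measure.volume_eq_prod, setLIntegral_prod_symm _ (by
      apply Measurable.aemeasurable
      have : Measurable ((A ∩ h ⁻¹' E).indicator (1 : ℂ → ℝ≥0∞)) :=
        measurable_one.indicator hAE
      simp only [smul_eq_mul]
      exact (ENNReal.measurable_ofReal.comp measurable_fst).mul (this.comp hs))]
  calc _ ≤ ∫⁻ θ in Ioo (-Real.pi) Real.pi,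
        Θ.indicator (fun _ => ENNReal.ofReal (1 / 4) * volume E) θ := by
        refine lintegral_mono fun θ => ?_
        by_cases hθ : θ ∈ Θ
        · rw [indicator_of_mem hθ]
          refine le_trans (setLIntegral_mono' measurableSet_Ioi fun ρ hρ => ?_)
            (lintegral_radial_le (hd θ) (hd' θ) E hE)
          simp only [smul_eq_mul]
          gcongr
          by_cases hmem : Complex.polarCoord.symm (ρ, θ) ∈ A ∩ h ⁻¹' E
          · rw [indicator_of_mem hmem, indicator_of_mem (by exact hmem.2)]; rfl
          · rw [indicator_of_notMem hmem]; exact zero_le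
        · rw [indicator_of_notMem hθ, nonpos_iff_eq_zero]
          rw [setLIntegral_congr_fun (g := fun _ => 0) measurableSet_Ioi]
          · simp
          · intro ρ hρ
            have : Complex.polarCoord.symm (ρ, θ) ∉ A ∩ h ⁻¹' E :=
              fun hmem => hθ (hAΘ θ ρ hρ hmem.1)
            simp only [smul_eq_mul, indicator_of_notMem this, mul_zero]
    _ = _ := by
        rw [lintegral_indicator hΘ, Measure.restrict_restrict hΘ, setLIntegral_const, mul_comm]

/-- Continuity from above: the sets decrease to {0}, the only zero of the sine in the open interval.
-/
theorem tendsto_volume_abs_sin_lt :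
    Tendsto (fun δ : ℝ => volume ({θ : ℝ | |Real.sin θ| < δ} ∩ Ioo (-Real.pi) Real.pi))
      (𝓝[>] 0) (𝓝 0) := by
  have hm : ∀ δ > (0 : ℝ), NullMeasurableSet
      ({θ : ℝ | |Real.sin θ| < δ} ∩ Ioo (-Real.pi) Real.pi) volume := fun δ _ =>
    ((isOpen_lt (by fun_prop) continuous_const).inter isOpen_Ioo).measurableSet.nullMeasurableSet
  have := tendsto_measure_biInter_gt (μ := volume) (a := (0 : ℝ))
    (s := fun δ : ℝ => {θ : ℝ | |Real.sin θ| < δ} ∩ Ioo (-Real.pi) Real.pi) hm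
    (fun i j _ hij θ hθ => ⟨lt_of_lt_of_le hθ.1 hij, hθ.2⟩)
    ⟨1, one_pos, ((measure_mono inter_subset_right).trans_lt
      (by rw [Real.volume_Ioo]; exact ENNReal.ofReal_lt_top)).ne⟩
  have h0 : volume (⋂ δ > (0 : ℝ), {θ : ℝ | |Real.sin θ| < δ} ∩ Ioo (-Real.pi) Real.pi) = 0 := ?_
  · rw [h0] at this
    exact this
  refine measure_mono_null (t := {0}) ?_ Real.volume_singleton
  intro θ hθ
  simp only [mem_iInter] at hθ
  have h0 : Real.sin θ = 0 := by
    by_contra hne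
    exact lt_irrefl |Real.sin θ| (hθ |Real.sin θ| (abs_pos.2 hne)).1
  have h1 := (hθ 1 one_pos).2
  rw [mem_singleton_iff]
  exact (Real.sin_eq_zero_iff_of_lt_of_lt h1.1 h1.2).1 h0

/-! ### Push-forward of Lebesgue measure under the sum map -/

/-- The sum of the two surface points above `p.1` and `p.2`. -/
noncomputable def surfaceSum (φ : Plane → ℝ) (p : Plane × Plane) : Plane × ℝ :=
  (p.1 + p.2, psi φ p.1 + psi φ p.2)

theorem continuous_psi {φ : Plane → ℝ} (hφ : Continuous φ) : Continuous (psi φ) := by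
  unfold psi; fun_prop

theorem continuous_surfaceSum {φ : Plane → ℝ} (hφ : Continuous φ) :
    Continuous (surfaceSum φ) := by
  have := continuous_psi hφ
  unfold surfaceSum; fun_prop

/-- By the parallelogram law the quadratic part is 2‖w‖² + 2ρ², which yields the term 4ρ whatever w
is. -/
theorem hasDerivAt_psi_add_psi {φ : Plane → ℝ} (hd : Differentiable ℝ φ)
    (w u : Plane) (hu : ‖u‖ = 1) (ρ : ℝ) :
    HasDerivAt (fun ρ : ℝ => psi φ (w + ρ • u) + psi φ (w - ρ • u))
      (4 * ρ + (fderiv ℝ φ (w + ρ • u) u - fderiv ℝ φ (w - ρ • u) u)) ρ := by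
  have e : (fun ρ : ℝ => psi φ (w + ρ • u) + psi φ (w - ρ • u)) =
      fun ρ : ℝ => (2 * ‖w‖ ^ 2 + 2 * ρ ^ 2) + (φ (w + ρ • u) + φ (w - ρ • u)) := by
    funext ρ
    have h1 := parallelogram_law_with_norm ℝ w (ρ • u)
    have h2 : ‖ρ • u‖ ^ 2 = ρ ^ 2 := by rw [norm_smul, hu, mul_one, Real.norm_eq_abs, sq_abs]
    simp only [psi]
    nlinarith
  rw [e]
  have hl : HasDerivAt (fun ρ : ℝ => ρ • u) u ρ := by
    simpa using (hasDerivAt_id ρ).smul_const u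
  have h1 := (hd (w + ρ • u)).hasFDerivAt.comp_hasDerivAt ρ (hl.const_add w)
  have h2 := (hd (w - ρ • u)).hasFDerivAt.comp_hasDerivAt ρ (hl.const_sub w)
  have h3 : HasDerivAt (fun ρ : ℝ => 2 * ‖w‖ ^ 2 + 2 * ρ ^ 2) (4 * ρ) ρ := by
    refine ((((hasDerivAt_id ρ).pow 2).const_mul 2).const_add (2 * ‖w‖ ^ 2)).congr_deriv ?_
    simp; ring
  refine (h3.add (h1.add h2)).congr_deriv ?_
  rw [map_neg, ← sub_eq_add_neg]

theorem hasDerivAt_comp_line {φ : Plane → ℝ} (hd : Differentiable ℝ φ) (w u : Plane) (t : ℝ) :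
    HasDerivAt (fun t : ℝ => φ (w + t • u)) (fderiv ℝ φ (w + t • u) u) t := by
  have hl : HasDerivAt (fun t : ℝ => w + t • u) u t := by
    simpa using ((hasDerivAt_id t).smul_const u).const_add w
  exact (hd (w + t • u)).hasFDerivAt.comp_hasDerivAt t hl

theorem convexOn_comp_line {φ : Plane → ℝ} (hc : ConvexOn ℝ univ φ) (w u : Plane) :
    ConvexOn ℝ univ (fun t : ℝ => φ (w + t • u)) := by
  have := hc.comp_affineMap (AffineMap.lineMap w (w + u) : ℝ →ᵃ[ℝ] Plane)
  have e : (fun t : ℝ => φ (w + t • u)) = φ ∘ (AffineMap.lineMap w (w + u) : ℝ →ᵃ[ℝ] Plane) := by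
    funext t
    simp [AffineMap.lineMap_apply, add_comm]
  rw [e]
  exact this

theorem fderiv_apply_le_of_convexOn {φ : Plane → ℝ} (hd : Differentiable ℝ φ)
    (hc : ConvexOn ℝ univ φ) (w u : Plane) {ρ : ℝ} (hρ : 0 ≤ ρ) :
    fderiv ℝ φ (w - ρ • u) u ≤ fderiv ℝ φ (w + ρ • u) u := by
  have hm := hasDerivAt_comp_line hd w u
  have := (convexOn_comp_line hc w u).monotoneOn_deriv (fun t _ => (hm t).differentiableAt)
    (mem_univ (-ρ)) (mem_univ ρ) (by linarith)
  rw [(hm _).deriv, (hm _).deriv, neg_smul, ← sub_eq_add_neg] at this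
  exact this

/-- The isometry `e` is left free so that the zero angle can later be aligned with a chosen axis. -/
theorem volume_fiber_le {φ : Plane → ℝ} (hd : Differentiable ℝ φ) (hc : ConvexOn ℝ univ φ)
    (w : Plane) (e : ℂ ≃ₗᵢ[ℝ] Plane) {U : Set Plane} (hU : MeasurableSet U)
    {Θ : Set ℝ} (hΘ : MeasurableSet Θ)
    (hUΘ : ∀ θ ρ, 0 < ρ → e (Complex.polarCoord.symm (ρ, θ)) ∈ U → θ ∈ Θ)
    {E : Set ℝ} (hE : MeasurableSet E) :
    volume (U ∩ {z | psi φ (w + z) + psi φ (w - z) ∈ E}) ≤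
      volume (Θ ∩ Ioo (-Real.pi) Real.pi) * (ENNReal.ofReal (1 / 4) * volume E) := by
  have hcont : Continuous fun z => psi φ (w + z) + psi φ (w - z) := by
    have := continuous_psi hd.continuous
    fun_prop
  have hmeas : MeasurableSet (U ∩ {z | psi φ (w + z) + psi φ (w - z) ∈ E}) :=
    hU.inter (hcont.measurable hE)
  rw [← e.measurePreserving.measure_preimage hmeas.nullMeasurableSet, preimage_inter]
  have hsm : ∀ θ ρ : ℝ, e (Complex.polarCoord.symm (ρ, θ)) =
      ρ • e (Complex.polarCoord.symm (1, θ)) := by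
    intro θ ρ
    rw [← map_smul]
    congr 1
    rw [Complex.polarCoord_symm_apply, Complex.polarCoord_symm_apply]
    simp [mul_add]
  have hn : ∀ θ : ℝ, ‖e (Complex.polarCoord.symm (1, θ))‖ = 1 := fun θ => by
    rw [e.norm_map, Complex.norm_polarCoord_symm]; simp
  refine volume_sector_preimage_le (h := fun ζ => psi φ (w + e ζ) + psi φ (w - e ζ))
    (hcont.comp e.continuous).measurable
    (h' := fun θ ρ => 4 * ρ + (fderiv ℝ φ (w + ρ • e (Complex.polarCoord.symm (1, θ)))
      (e (Complex.polarCoord.symm (1, θ))) -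
      fderiv ℝ φ (w - ρ • e (Complex.polarCoord.symm (1, θ)))
      (e (Complex.polarCoord.symm (1, θ))))) ?_ ?_
    (e.continuous.measurable hU) hΘ hUΘ hE
  · intro θ ρ _
    have := hasDerivAt_psi_add_psi hd w _ (hn θ) ρ
    simp only [← hsm θ] at this ⊢
    exact this
  · intro θ ρ hρ
    have := fderiv_apply_le_of_convexOn hd hc w (e (Complex.polarCoord.symm (1, θ))) hρ.le
    linarith

/-- The change of variables is a shear y' = ξ - y followed by the translation y = ξ/2 + z, so no
Jacobian factor appears. -/
theorem lintegral_prod_midpoint {F : Plane × Plane → ℝ≥0∞} (hF : Measurable F) :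
    ∫⁻ p, F p = ∫⁻ ξ : Plane, ∫⁻ z : Plane,
      F ((1 / 2 : ℝ) • ξ + z, (1 / 2 : ℝ) • ξ - z) := by
  rw [Measure.volume_eq_prod, lintegral_prod _ hF.aemeasurable]
  have h1 : ∀ y : Plane, ∫⁻ y', F (y, y') = ∫⁻ ξ, F (y, ξ - y) := fun y =>
    (lintegral_sub_right_eq_self (fun y' => F (y, y')) y).symm
  simp_rw [h1]
  rw [lintegral_lintegral_swap (by
    apply Measurable.aemeasurable
    exact hF.comp (measurable_fst.prodMk (measurable_snd.sub measurable_fst)))]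
  refine lintegral_congr fun ξ => ?_
  rw [← lintegral_add_left_eq_self (fun y => F (y, ξ - y)) ((1 / 2 : ℝ) • ξ)]
  refine lintegral_congr fun z => ?_
  congr 2
  module

/-- In midpoint variables the planar component of the sum map is ξ itself, so Fubini reduces the
comparison of measures to one-dimensional estimates on the fibres over ξ. -/
theorem map_surfaceSum_restrict_le {φ : Plane → ℝ} (hφ : Continuous φ)
    {P : Set (Plane × Plane)} (hP : MeasurableSet P) (C : ℝ≥0∞)
    (h : ∀ ξ : Plane, ∀ B : Set ℝ, MeasurableSet B →
      volume ({z : Plane | ((1 / 2 : ℝ) • ξ + z, (1 / 2 : ℝ) • ξ - z) ∈ P} ∩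
        {z | psi φ ((1 / 2 : ℝ) • ξ + z) + psi φ ((1 / 2 : ℝ) • ξ - z) ∈ B}) ≤ C * volume B) :
    (volume.restrict P).map (surfaceSum φ) ≤ C • (volume : Measure (Plane × ℝ)) := by
  have hS := (continuous_surfaceSum hφ).measurable
  refine Measure.le_iff.2 fun E hE => ?_
  rw [Measure.map_apply hS hE, Measure.restrict_apply (hS hE), Measure.smul_apply, smul_eq_mul]
  have hm : MeasurableSet (surfaceSum φ ⁻¹' E ∩ P) := (hS hE).inter hP
  rw [← lintegral_indicator_one hm, lintegral_prod_midpoint (measurable_one.indicator hm),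
    Measure.volume_eq_prod Plane ℝ, Measure.prod_apply hE,
    ← lintegral_const_mul _ (measurable_measure_prodMk_left hE)]
  refine lintegral_mono fun ξ => ?_
  refine le_trans ?_ (h ξ (Prod.mk ξ ⁻¹' E) (measurable_prodMk_left hE))
  have hj : Measurable fun z : Plane => ((1 / 2 : ℝ) • ξ + z, (1 / 2 : ℝ) • ξ - z) := by fun_prop
  refine (lintegral_indicator_one (hj hm)).le.trans (measure_mono ?_)
  intro z hz
  refine ⟨hz.2, ?_⟩
  have h1 := hz.1
  simp only [mem_preimage, surfaceSum] at h1
  have h2 : (1 / 2 : ℝ) • ξ + z + ((1 / 2 : ℝ) • ξ - z) = ξ := by module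
  rw [h2] at h1
  exact h1

theorem map_surfaceSum_le {φ : Plane → ℝ} (hd : Differentiable ℝ φ) (hc : ConvexOn ℝ univ φ) :
    (volume.restrict univ).map (surfaceSum φ) ≤
      ENNReal.ofReal (Real.pi / 2) • (volume : Measure (Plane × ℝ)) := by
  refine map_surfaceSum_restrict_le hd.continuous MeasurableSet.univ _ fun ξ B hB => ?_
  refine (volume_fiber_le hd hc ((1 / 2 : ℝ) • ξ) Complex.orthonormalBasisOneI.repr
    (U := {z : Plane | ((1 / 2 : ℝ) • ξ + z, (1 / 2 : ℝ) • ξ - z) ∈ univ}) (by simp)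
    MeasurableSet.univ (fun _ _ _ _ => mem_univ _) hB).trans ?_
  rw [univ_inter, Real.volume_Ioo, ← mul_assoc, ← ENNReal.ofReal_mul (by linarith [Real.pi_pos])]
  gcongr
  linarith

/-! ### Separated pairs of points -/

/-- The measure of the directions making a small angle with a fixed line, up to a factor. -/
noncomputable def sectorConst (δ : ℝ) : ℝ≥0∞ :=
  volume ({θ : ℝ | |Real.sin θ| < δ} ∩ Ioo (-Real.pi) Real.pi) * ENNReal.ofReal (1 / 4)

theorem sectorConst_ne_top (δ : ℝ) : sectorConst δ ≠ ∞ :=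
  ENNReal.mul_ne_top ((measure_mono inter_subset_right).trans_lt
      (by rw [Real.volume_Ioo]; exact ENNReal.ofReal_lt_top)).ne ENNReal.ofReal_ne_top

theorem tendsto_sectorConst : Tendsto sectorConst (𝓝[>] 0) (𝓝 0) := by
  have := ENNReal.Tendsto.mul_const (b := ENNReal.ofReal (1 / 4)) tendsto_volume_abs_sin_lt
    (Or.inr ENNReal.ofReal_ne_top)
  rwa [zero_mul] at this

/-- Writing the condition with the factor ‖u‖ also covers u = 0, where any isometry works. -/
theorem exists_isometry_apply_one (u : Plane) :
    ∃ e : ℂ ≃ₗᵢ[ℝ] Plane, (‖u‖ : ℝ) • e 1 = u := by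
  set b := Complex.orthonormalBasisOneI.repr
  set ζ : ℂ := b.symm u
  have hζ : ‖ζ‖ = ‖u‖ := b.symm.norm_map u
  refine ⟨(rotation (Circle.exp ζ.arg)).trans b, ?_⟩
  rw [LinearIsometryEquiv.trans_apply, rotation_apply, mul_one, ← map_smul, Circle.coe_exp, ← hζ,
    Complex.real_smul, Complex.norm_mul_exp_arg_mul_I]
  exact b.apply_symm_apply u

/-- Here 2‖z‖ = ‖y - y'‖ > R - r, while z is within r of c - ξ/2, hence within r of the line through
the origin and c - ξ/2. Measuring θ from this line gives ρ|sin θ| < r, so |sin θ| < 2r/(R - r). The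
bound depends on neither c nor ξ. -/
theorem map_surfaceSum_separated_le {φ : Plane → ℝ} (hd : Differentiable ℝ φ)
    (hc : ConvexOn ℝ univ φ) {c : Plane} {r R : ℝ} (hR : r < R)
    {P : Set (Plane × Plane)} (hP : MeasurableSet P)
    (hsub : P ⊆ Metric.ball c r ×ˢ (Metric.ball c R)ᶜ) :
    (volume.restrict P).map (surfaceSum φ) ≤
      sectorConst (2 * r / (R - r)) • (volume : Measure (Plane × ℝ)) := by
  refine map_surfaceSum_restrict_le hd.continuous hP _ fun ξ B hB => ?_
  obtain ⟨e, he⟩ := exists_isometry_apply_one (c - (1 / 2 : ℝ) • ξ)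
  have hj : Measurable fun z : Plane => ((1 / 2 : ℝ) • ξ + z, (1 / 2 : ℝ) • ξ - z) := by fun_prop
  have := volume_fiber_le hd hc ((1 / 2 : ℝ) • ξ) e
    (U := {z : Plane | ((1 / 2 : ℝ) • ξ + z, (1 / 2 : ℝ) • ξ - z) ∈ P}) (hj hP)
    (Θ := {θ : ℝ | |Real.sin θ| < 2 * r / (R - r)})
    (isOpen_lt (by fun_prop) continuous_const).measurableSet ?_ hB
  · rwa [← mul_assoc] at this
  intro θ ρ hρ hz
  obtain ⟨h1, h2⟩ := hsub hz
  set z := e (Complex.polarCoord.symm (ρ, θ)) with hzdef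
  simp only [Metric.mem_ball, mem_compl_iff, not_lt, dist_eq_norm] at h1 h2
  have hnz : ‖z‖ = ρ := by
    rw [hzdef, e.norm_map, Complex.norm_polarCoord_symm]; exact abs_of_pos hρ
  have hfar : R - r ≤ 2 * ρ := by
    have h3 : (1 / 2 : ℝ) • ξ - z - c = ((1 / 2 : ℝ) • ξ + z - c) - (2 : ℝ) • z := by module
    rw [h3] at h2
    have h4 := norm_sub_le ((1 / 2 : ℝ) • ξ + z - c) ((2 : ℝ) • z)
    rw [norm_smul, hnz, Real.norm_eq_abs, abs_of_pos (by norm_num : (0 : ℝ) < 2)] at h4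
    linarith
  have hsin : ρ * |Real.sin θ| < r := by
    refine lt_of_le_of_lt ?_ h1
    have h3 : (1 / 2 : ℝ) • ξ + z - c = e (Complex.polarCoord.symm (ρ, θ) -
        (‖c - (1 / 2 : ℝ) • ξ‖ : ℂ)) := by
      have h4 : e (‖c - (1 / 2 : ℝ) • ξ‖ : ℂ) = c - (1 / 2 : ℝ) • ξ := by
        have h5 : ((‖c - (1 / 2 : ℝ) • ξ‖ : ℝ) : ℂ) = ‖c - (1 / 2 : ℝ) • ξ‖ • (1 : ℂ) := by simp
        rw [h5, map_smul, he]
      rw [map_sub, h4]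
      abel
    rw [h3, e.norm_map]
    refine le_trans (le_of_eq ?_) (Complex.abs_im_le_norm _)
    rw [Complex.sub_im, Complex.ofReal_im, sub_zero, Complex.polarCoord_symm_apply,
      Complex.im_ofReal_mul, abs_mul, abs_of_pos hρ]
    simp [-Complex.ofReal_cos, -Complex.ofReal_sin]
  rw [mem_ofPred_eq, lt_div_iff₀ (by linarith)]
  have := mul_le_mul_of_nonneg_left hfar (abs_nonneg (Real.sin θ))
  linarith

/-! ### Duality between composition and push-forward -/

section Pullback

variable {X Y : Type*} [MeasurableSpace X] [MeasurableSpace Y] {μ : Measure X} {ν : Measure Y}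
  {S : X → Y} {C : ℝ≥0∞}

theorem memLp_comp_of_map_le (hS : Measurable S) (hC : C ≠ ∞) (h : μ.map S ≤ C • ν) {g : Y → ℂ}
    (hg : MemLp g 2 ν) : MemLp (g ∘ S) 2 μ :=
  (hg.of_measure_le_smul hC h).comp_of_map hS.aemeasurable

theorem eLpNorm_comp_le_of_map_le (hS : Measurable S) (h : μ.map S ≤ C • ν) {g : Y → ℂ}
    (hg : AEStronglyMeasurable g ν) :
    eLpNorm (g ∘ S) 2 μ ≤ C ^ (1 / 2 : ℝ) * eLpNorm g 2 ν := by
  have hac : μ.map S ≪ ν := Measure.absolutelyContinuous_of_le_smul h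
  rw [← eLpNorm_map_measure (hg.mono_ac hac) hS.aemeasurable]
  simpa using eLpNorm_le_of_measure_le_smul h (f := g) (p := 2)

theorem ae_eq_comp_of_map_le (hS : Measurable S) (h : μ.map S ≤ C • ν) {g g' : Y → ℂ}
    (hg : g =ᵐ[ν] g') : g ∘ S =ᵐ[μ] g' ∘ S :=
  ae_eq_comp hS.aemeasurable ((Measure.absolutelyContinuous_of_le_smul h).ae_eq hg)

/-- Composition with `S` as an operator `L²(ν) → L²(μ)`. -/
noncomputable def pullback (hS : Measurable S) (hC : C ≠ ∞) (h : μ.map S ≤ C • ν) :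
    Lp ℂ 2 ν →L[ℂ] Lp ℂ 2 μ :=
  LinearMap.mkContinuous
    { toFun := fun g => (memLp_comp_of_map_le hS hC h (Lp.memLp g)).toLp
      map_add' := fun g g' => by
        rw [← MemLp.toLp_add, MemLp.toLp_eq_toLp_iff]
        exact ae_eq_comp_of_map_le hS h (Lp.coeFn_add g g')
      map_smul' := fun c g => by
        rw [RingHom.id_apply, ← MemLp.toLp_const_smul, MemLp.toLp_eq_toLp_iff]
        exact ae_eq_comp_of_map_le hS h (Lp.coeFn_smul c g) }
    (C ^ (1 / 2 : ℝ)).toReal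
    (fun g => by
      have := eLpNorm_comp_le_of_map_le hS h (Lp.memLp g).aestronglyMeasurable
      rw [LinearMap.coe_mk, AddHom.coe_mk, Lp.norm_toLp, Lp.norm_def, ← ENNReal.toReal_mul]
      refine ENNReal.toReal_mono (ENNReal.mul_ne_top ?_ (Lp.eLpNorm_ne_top g)) this
      exact ENNReal.rpow_ne_top_of_nonneg (by norm_num) hC)

theorem coeFn_pullback (hS : Measurable S) (hC : C ≠ ∞) (h : μ.map S ≤ C • ν) (g : Lp ℂ 2 ν) :
    pullback hS hC h g =ᵐ[μ] g ∘ S :=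
  (memLp_comp_of_map_le hS hC h (Lp.memLp g)).coeFn_toLp

/-- The adjoint of composition with `S`: the density of the push-forward of `F • μ`. -/
noncomputable def pushforward (hS : Measurable S) (hC : C ≠ ∞) (h : μ.map S ≤ C • ν) :
    Lp ℂ 2 μ →L[ℂ] Lp ℂ 2 ν :=
  ContinuousLinearMap.adjoint (pullback hS hC h)

/-- With T the composition operator and G = T*F, ‖G‖² = ⟨F, TG⟩. As F vanishes off P, only TG
restricted to P enters, and there the constant C' replaces C. -/
theorem norm_pushforward_le (hS : Measurable S) (hC : C ≠ ∞) (h : μ.map S ≤ C • ν)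
    {P : Set X} (hP : MeasurableSet P) {C' : ℝ≥0∞} (hC' : C' ≠ ∞)
    (h' : (μ.restrict P).map S ≤ C' • ν) (F : Lp ℂ 2 μ) (hF : ∀ᵐ x ∂μ, x ∉ P → F x = 0) :
    ‖pushforward hS hC h F‖ ≤ √C'.toReal * ‖F‖ := by
  set G := pushforward hS hC h F with hG
  set u := pullback hS hC h G with hu
  have hmem : MemLp (P.indicator u) 2 μ := (Lp.memLp u).indicator hP
  set v : Lp ℂ 2 μ := hmem.toLp with hv
  have hin : inner ℂ F u = inner ℂ F v := by
    rw [L2.inner_def, L2.inner_def]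
    refine integral_congr_ae ?_
    filter_upwards [hF, hmem.coeFn_toLp] with x hx hvx
    rw [hv, hvx]
    by_cases hxP : x ∈ P
    · rw [indicator_of_mem hxP]
    · rw [hx hxP]; simp
  have hvn : ‖v‖ ≤ √C'.toReal * ‖G‖ := by
    rw [hv, Lp.norm_toLp, eLpNorm_indicator_eq_eLpNorm_restrict hP,
      eLpNorm_congr_ae (ae_restrict_of_ae (coeFn_pullback hS hC h G)), Lp.norm_def,
      Real.sqrt_eq_rpow, ENNReal.toReal_rpow, ← ENNReal.toReal_mul]
    refine ENNReal.toReal_mono (ENNReal.mul_ne_top ?_ (Lp.eLpNorm_ne_top G))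
      (eLpNorm_comp_le_of_map_le hS h' (Lp.memLp G).aestronglyMeasurable)
    exact ENNReal.rpow_ne_top_of_nonneg (by norm_num) hC'
  have hsq : ‖G‖ * ‖G‖ ≤ ‖F‖ * (√C'.toReal * ‖G‖) := by
    have h1 : inner ℂ G G = inner ℂ F v := by
      rw [← hin, hu, ← ContinuousLinearMap.adjoint_inner_left (pullback hS hC h) G F]; rfl
    have h2 : ‖G‖ * ‖G‖ = ‖inner ℂ G G‖ := by
      rw [inner_self_eq_norm_sq_to_K, ← sq]; simp
    rw [h2, h1]
    exact (norm_inner_le_norm F v).trans (by gcongr)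
  rcases eq_or_lt_of_le (norm_nonneg G) with h0 | h0
  · rw [← h0]; positivity
  · exact le_of_mul_le_mul_right (by linarith) h0

/-- Cauchy–Schwarz for ⟨T*Tg, g⟩ = ‖Tg‖². It bounds the push-forward from below on any function that
factors through S. -/
theorem norm_sq_le_norm_pushforward_mul (hS : Measurable S) (hC : C ≠ ∞) (h : μ.map S ≤ C • ν)
    (g : Lp ℂ 2 ν) :
    ‖pullback hS hC h g‖ ^ 2 ≤ ‖pushforward hS hC h (pullback hS hC h g)‖ * ‖g‖ := by
  have h1 := norm_inner_le_norm (𝕜 := ℂ) (pushforward hS hC h (pullback hS hC h g)) g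
  rw [pushforward, ContinuousLinearMap.adjoint_inner_left] at h1
  refine le_trans (le_of_eq ?_) h1
  rw [inner_self_eq_norm_sq_to_K]; simp

/-- Pairing the adjoint with an indicator function shows that it is the density of the push-forward.
-/
theorem setIntegral_pushforward (hS : Measurable S) (hC : C ≠ ∞) (h : μ.map S ≤ C • ν)
    (F : Lp ℂ 2 μ) {E : Set Y} (hE : MeasurableSet E) (hνE : ν E ≠ ∞) :
    ∫ y in E, pushforward hS hC h F y ∂ν = ∫ x in S ⁻¹' E, F x ∂μ := by
  rw [← L2.inner_indicatorConstLp_one (𝕜 := ℂ) hE hνE, pushforward,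
    ContinuousLinearMap.adjoint_inner_right, L2.inner_def, ← integral_indicator (hS hE)]
  refine integral_congr_ae ?_
  filter_upwards [coeFn_pullback hS hC h (indicatorConstLp 2 hE hνE (1 : ℂ)),
    ae_eq_comp_of_map_le hS h (indicatorConstLp_coeFn (s := E) (hs := hE) (hμs := hνE) (p := 2)
      (c := (1 : ℂ)))] with x hx hx'
  rw [hx, hx']
  by_cases hxE : S x ∈ E
  · rw [indicator_of_mem (show x ∈ S ⁻¹' E from hxE), Function.comp_apply,
      indicator_of_mem hxE]
    simp
  · rw [indicator_of_notMem (show x ∉ S ⁻¹' E from hxE), Function.comp_apply,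
      indicator_of_notMem hxE]
    simp

end Pullback

/-! ### Tensor squares and the density of the convolution -/

theorem Lp_norm_sq_eq_integral {X : Type*} [MeasurableSpace X] {μ : Measure X} (u : Lp ℂ 2 μ) :
    ‖u‖ ^ 2 = ∫ x, ‖u x‖ ^ 2 ∂μ := by
  have h1 : (inner ℂ u u : ℂ) = ((‖u‖ ^ 2 : ℝ) : ℂ) := by
    rw [inner_self_eq_norm_sq_to_K]; simp
  rw [L2.inner_def] at h1
  have h2 : ∀ x, (inner ℂ (u x) (u x) : ℂ) = ((‖u x‖ ^ 2 : ℝ) : ℂ) := fun x => by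
    rw [inner_self_eq_norm_sq_to_K]; simp
  simp_rw [h2] at h1
  rw [integral_complex_ofReal] at h1
  exact_mod_cast h1.symm

theorem memLp_tensor {f : Plane → ℂ} (hf : MemLp f 2 volume) :
    MemLp (fun p : Plane × Plane => f p.1 * f p.2) 2 volume := by
  rw [memLp_two_iff_integrable_sq_norm]
  · have := (memLp_two_iff_integrable_sq_norm hf.aestronglyMeasurable).1 hf
    simp only [norm_mul, mul_pow]
    exact this.mul_prod this
  · exact hf.aestronglyMeasurable.comp_fst.mul hf.aestronglyMeasurable.comp_snd

/-- `f ⊗ f` as an element of `L²`. -/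
noncomputable def tensor (f : L2Plane) : Lp ℂ 2 (volume : Measure (Plane × Plane)) :=
  (memLp_tensor (Lp.memLp f)).toLp

theorem coeFn_tensor (f : L2Plane) : tensor f =ᵐ[volume] fun p => f p.1 * f p.2 :=
  MemLp.coeFn_toLp _

theorem norm_tensor (f : L2Plane) : ‖tensor f‖ = ‖f‖ ^ 2 := by
  have h : ‖tensor f‖ ^ 2 = (‖f‖ ^ 2) ^ 2 := by
    rw [Lp_norm_sq_eq_integral, Lp_norm_sq_eq_integral, sq (∫ _, _), ← integral_prod_mul]
    refine integral_congr_ae ?_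
    filter_upwards [coeFn_tensor f] with p hp
    rw [hp, norm_mul, mul_pow]
  exact (pow_left_inj₀ (norm_nonneg _) (by positivity) two_ne_zero).1 h

theorem map_surfaceSum_le' {φ : Plane → ℝ} (hd : Differentiable ℝ φ) (hc : ConvexOn ℝ univ φ) :
    volume.map (surfaceSum φ) ≤
      ENNReal.ofReal (Real.pi / 2) • (volume : Measure (Plane × ℝ)) := by
  have := map_surfaceSum_le hd hc
  rwa [Measure.restrict_univ] at this

/-- Composition with `surfaceSum φ` on `L²`. -/
noncomputable def surfacePullback {φ : Plane → ℝ} (hd : Differentiable ℝ φ)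
    (hc : ConvexOn ℝ univ φ) : Lp ℂ 2 (volume : Measure (Plane × ℝ)) →L[ℂ]
      Lp ℂ 2 (volume : Measure (Plane × Plane)) :=
  pullback (continuous_surfaceSum hd.continuous).measurable ENNReal.ofReal_ne_top
    (map_surfaceSum_le' hd hc)

/-- The density of `F(y, y') dy dy'` transported by `surfaceSum φ`. -/
noncomputable def surfaceDensity {φ : Plane → ℝ} (hd : Differentiable ℝ φ)
    (hc : ConvexOn ℝ univ φ) : Lp ℂ 2 (volume : Measure (Plane × Plane)) →L[ℂ]
      Lp ℂ 2 (volume : Measure (Plane × ℝ)) :=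
  pushforward (continuous_surfaceSum hd.continuous).measurable ENNReal.ofReal_ne_top
    (map_surfaceSum_le' hd hc)

theorem isConvDensity_surfaceDensity {φ : Plane → ℝ} (hd : Differentiable ℝ φ)
    (hc : ConvexOn ℝ univ φ) (f : L2Plane) :
    IsConvDensity φ f f (surfaceDensity hd hc (tensor f)) := by
  refine ⟨(Lp.memLp _).locallyIntegrable (by norm_num), fun E hE hbd => ?_⟩
  have hG : Measurable fun y : Plane => (y, psi φ y) :=
    measurable_id.prodMk (continuous_psi hd.continuous).measurable
  have hfm : Measurable f := (Lp.stronglyMeasurable f).measurable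
  have hint : Measurable fun pq : (Plane × ℝ) × (Plane × ℝ) =>
      E.indicator (fun _ => f pq.1.1 * f pq.2.1) (pq.1 + pq.2) := by
    have h1 : MeasurableSet {pq : (Plane × ℝ) × (Plane × ℝ) | pq.1 + pq.2 ∈ E} :=
      (measurable_fst.add measurable_snd) hE
    have h2 : Measurable fun pq : (Plane × ℝ) × (Plane × ℝ) => f pq.1.1 * f pq.2.1 := by
      fun_prop
    exact h2.indicator h1
  rw [surfaceDensity, setIntegral_pushforward _ _ _ _ hE hbd.measure_lt_top.ne, projMeasure,
    Measure.map_prod_map _ _ hG hG, integral_map (hG.prodMap hG).aemeasurable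
    hint.aestronglyMeasurable,
    ← integral_indicator ((continuous_surfaceSum hd.continuous).measurable hE)]
  refine integral_congr_ae ?_
  filter_upwards [coeFn_tensor f] with p hp
  by_cases hpE : surfaceSum φ p ∈ E
  · rw [indicator_of_mem (show p ∈ surfaceSum φ ⁻¹' E from hpE), hp]
    exact (indicator_of_mem (s := E) hpE (fun _ => f p.1 * f p.2)).symm
  · rw [indicator_of_notMem (show p ∉ surfaceSum φ ⁻¹' E from hpE)]
    exact (indicator_of_notMem (s := E) hpE (fun _ => f p.1 * f p.2)).symm

theorem IsConvDensity.ae_eq {φ : Plane → ℝ} {f g : Plane → ℂ} {F G : Plane × ℝ → ℂ}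
    (hF : IsConvDensity φ f g F) (hG : IsConvDensity φ f g G) : F =ᵐ[volume] G := by
  have := ae_eq_zero_of_forall_setIntegral_isCompact_eq_zero' (hF.1.sub hG.1) fun s hs => by
    have h1 := hF.2 s hs.measurableSet hs.isBounded
    have h2 := hG.2 s hs.measurableSet hs.isBounded
    simp only [Pi.sub_apply]
    rw [integral_sub (hF.1.integrableOn_isCompact hs) (hG.1.integrableOn_isCompact hs), h1, h2,
      sub_self]
  filter_upwards [this] with x hx
  exact sub_eq_zero.1 hx

/-- Uniqueness of the density collapses the infimum to one value, so the nonlinear quantity becomes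
a bounded linear operator applied to `f ⊗ f`. -/
theorem convNorm_eq {φ : Plane → ℝ} (hd : Differentiable ℝ φ)
    (hc : ConvexOn ℝ univ φ) (f : L2Plane) :
    convNorm φ f f = ‖surfaceDensity hd hc (tensor f)‖ₑ := by
  have h := isConvDensity_surfaceDensity hd hc f
  rw [Lp.enorm_def]
  refine le_antisymm (iInf₂_le _ h) (le_iInf₂ fun F hF => ?_)
  rw [eLpNorm_congr_ae (h.ae_eq hF)]

/-! ### Lower bound for the optimal constant -/

/-- Either alternative supplies a point c with ‖H(φ)(c)‖ < ε. The bound persists near c by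
continuity, and the mean value inequality is applied to the gradient and then to φ. -/
theorem exists_small_second_order_remainder {φ : Plane → ℝ} (hφ : ContDiff ℝ 2 φ)
    (hH : (∃ y₀, hessian φ y₀ = 0) ∨
      (∃ y : ℕ → Plane, Tendsto (fun n => ‖y n‖) atTop atTop ∧
        Tendsto (fun n => hessian φ (y n)) atTop (𝓝 0)))
    {ε : ℝ} (hε : 0 < ε) :
    ∃ c : Plane, ∃ δ : ℝ, 0 < δ ∧ ∀ y, ‖y - c‖ < δ →
      φ y - φ c - fderiv ℝ φ c (y - c) ≤ ε * ‖y - c‖ ^ 2 := by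
  obtain ⟨c, hc⟩ : ∃ c, ‖hessian φ c‖ < ε := by
    rcases hH with ⟨y₀, h0⟩ | ⟨y, -, hy⟩
    · exact ⟨y₀, by rw [h0]; exact (norm_zero (E := Plane →L[ℝ] Plane →L[ℝ] ℝ)).trans_lt hε⟩
    · have : Tendsto (fun n => ‖hessian φ (y n)‖) atTop (𝓝 0) :=
        (tendsto_norm_zero (E := Plane →L[ℝ] Plane →L[ℝ] ℝ)).comp hy
      obtain ⟨n, hn⟩ := (this.eventually (gt_mem_nhds hε)).exists
      exact ⟨y n, hn⟩
  have h1 : ContDiff ℝ 1 (fderiv ℝ φ) := hφ.fderiv_right (by norm_num)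
  have hcont : Continuous (fun y => ‖hessian φ y‖) := (h1.continuous_fderiv one_ne_zero).norm
  obtain ⟨δ, hδ, hball⟩ := Metric.mem_nhds_iff.1 (hcont.continuousAt.eventually (gt_mem_nhds hc))
  refine ⟨c, δ, hδ, fun y hy => ?_⟩
  have hgrad : ∀ x ∈ Metric.ball c δ, ‖fderiv ℝ φ x - fderiv ℝ φ c‖ ≤ ε * ‖x - c‖ := by
    intro x hx
    exact (convex_ball c δ).norm_image_sub_le_of_norm_fderiv_le (𝕜 := ℝ)
      (fun z _ => (h1.differentiable one_ne_zero) z) (fun z hz => (hball hz).le)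
      (Metric.mem_ball_self hδ) hx
  have := (convex_closedBall c ‖y - c‖).norm_image_sub_le_of_norm_fderiv_le' (𝕜 := ℝ)
    (f := φ) (φ := fderiv ℝ φ c) (C := ε * ‖y - c‖)
    (fun z _ => (hφ.differentiable two_ne_zero) z)
    (fun z hz => by
      rw [Metric.mem_closedBall, dist_eq_norm] at hz
      refine (hgrad z ?_).trans (by gcongr)
      rw [Metric.mem_ball, dist_eq_norm]
      exact hz.trans_lt hy)
    (Metric.mem_closedBall_self (norm_nonneg _))
    (by rw [Metric.mem_closedBall, dist_eq_norm])
  refine (le_abs_self _).trans (this.trans (le_of_eq (by ring)))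

theorem tangent_le {φ : Plane → ℝ} (hd : Differentiable ℝ φ) (hc : ConvexOn ℝ univ φ)
    (c y : Plane) : 0 ≤ φ y - φ c - fderiv ℝ φ c (y - c) := by
  have h1 := hasDerivAt_comp_line hd c (y - c) 0
  have h2 := (convexOn_comp_line hc c (y - c)).le_slope_of_hasDerivAt (mem_univ 0) (mem_univ 1)
    one_pos h1
  simp only [slope_def_field, zero_smul, add_zero, one_smul, add_sub_cancel, sub_zero,
    div_one] at h2
  linarith

theorem integral_gaussian_plane {b : ℝ} (hb : 0 < b) (c : Plane) :
    ∫ y : Plane, Real.exp (-b * ‖y - c‖ ^ 2) = Real.pi / b := by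
  rw [integral_sub_right_eq_self (fun y : Plane => Real.exp (-b * ‖y‖ ^ 2)) c,
    GaussianFourier.integral_rexp_neg_mul_sq_norm hb]
  simp

theorem integrable_gaussian_plane {b : ℝ} (hb : 0 < b) (c : Plane) :
    Integrable fun y : Plane => Real.exp (-b * ‖y - c‖ ^ 2) :=
  Integrable.of_integral_ne_zero (by
    rw [integral_gaussian_plane hb c]; have := Real.pi_pos; positivity)

/-- The difference between `psi φ` and its affine part at `c`. -/
noncomputable def psiTangent (φ : Plane → ℝ) (c y : Plane) : ℝ :=
  ‖y - c‖ ^ 2 + (φ y - φ c - fderiv ℝ φ c (y - c))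

/-- Twice the affine part of `psi φ` at `c`, evaluated at `ξ / 2`. -/
noncomputable def affinePart (φ : Plane → ℝ) (c ξ : Plane) : ℝ :=
  2 * inner ℝ ξ c - 2 * ‖c‖ ^ 2 + 2 * φ c + fderiv ℝ φ c (ξ - (2 : ℝ) • c)

theorem continuous_psiTangent {φ : Plane → ℝ} (hd : Differentiable ℝ φ) (c : Plane) :
    Continuous (psiTangent φ c) := by
  have := hd.continuous
  unfold psiTangent; fun_prop

theorem continuous_affinePart (φ : Plane → ℝ) (c : Plane) :
    Continuous (affinePart φ c) := by
  unfold affinePart; fun_prop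

/-- The affine part depends only on y + y', so the tensor square of exp(-l · `psiTangent`) is a
function of S(y, y'). This makes these trial functions computable. -/
theorem psi_add_psi_sub_affinePart (φ : Plane → ℝ) (c y y' : Plane) :
    psi φ y + psi φ y' - affinePart φ c (y + y') = psiTangent φ c y + psiTangent φ c y' := by
  have h1 : y + y' - (2 : ℝ) • c = (y - c) + (y' - c) := by module
  have h2 := @norm_sub_sq_real _ _ _ y c
  have h3 := @norm_sub_sq_real _ _ _ y' c
  simp only [psi, psiTangent, affinePart, h1, map_add, inner_add_left, h2, h3]
  ring

/-- This places the image of S in the region where `expAbove` is not cut off. -/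
theorem half_norm_sq_le_psiTangent {φ : Plane → ℝ} (hd : Differentiable ℝ φ)
    (hc : ConvexOn ℝ univ φ) (c y y' : Plane) :
    ‖y + y' - (2 : ℝ) • c‖ ^ 2 / 2 ≤ psiTangent φ c y + psiTangent φ c y' := by
  have h1 : y + y' - (2 : ℝ) • c = (y - c) + (y' - c) := by module
  have h2 := parallelogram_law_with_norm ℝ (y - c) (y' - c)
  have h3 := tangent_le hd hc c y
  have h4 := tangent_le hd hc c y'
  rw [h1]
  unfold psiTangent
  nlinarith [sq_nonneg ‖y - c - (y' - c)‖]

theorem memLp_exp_psiTangent {φ : Plane → ℝ} (hd : Differentiable ℝ φ)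
    (hc : ConvexOn ℝ univ φ) (c : Plane) {l : ℝ} (hl : 0 < l) :
    MemLp (fun y => (Real.exp (-l * psiTangent φ c y) : ℂ)) 2 volume := by
  have hcont : Continuous fun y => (Real.exp (-l * psiTangent φ c y) : ℂ) := by
    have := continuous_psiTangent hd c
    fun_prop
  rw [memLp_two_iff_integrable_sq_norm hcont.aestronglyMeasurable]
  refine (integrable_gaussian_plane (b := 2 * l) (by positivity) c).mono'
    (hcont.norm.pow 2).aestronglyMeasurable (ae_of_all _ fun y => ?_)
  rw [Complex.norm_real, norm_pow, norm_norm, Real.norm_eq_abs, Real.abs_exp, ← Real.exp_nat_mul,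
    Real.exp_le_exp]
  have := tangent_le hd hc c y
  simp only [psiTangent]
  push_cast
  nlinarith

/-- The function on `ℝ² × ℝ` whose composition with `surfaceSum φ` is the tensor square of
`exp (-l * psiTangent φ c)`. -/
noncomputable def expAbove (φ : Plane → ℝ) (c : Plane) (l : ℝ) (q : Plane × ℝ) : ℝ :=
  {q : Plane × ℝ | affinePart φ c q.1 + ‖q.1 - (2 : ℝ) • c‖ ^ 2 / 2 ≤ q.2}.indicator
    (fun q => Real.exp (-l * (q.2 - affinePart φ c q.1))) q

theorem measurable_expAbove (φ : Plane → ℝ) (c : Plane) (l : ℝ) :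
    Measurable (expAbove φ c l) := by
  have h := continuous_affinePart φ c
  refine Measurable.indicator ?_ ?_
  · exact Continuous.measurable (by fun_prop)
  · exact (isClosed_le (by fun_prop) (by fun_prop)).measurableSet

/-- The inner integral over the half-line of τ is a Gaussian in ξ with factor 1/(2l), whose integral
over the plane contributes π/l. -/
theorem integral_expAbove_sq (φ : Plane → ℝ) (c : Plane) {l : ℝ} (hl : 0 < l) :
    Integrable (fun q => expAbove φ c l q ^ 2) ∧
      ∫ q, expAbove φ c l q ^ 2 = Real.pi / (2 * l ^ 2) := by
  have hfib : ∀ ξ : Plane, (fun τ : ℝ => expAbove φ c l (ξ, τ) ^ 2) =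
      (Ici (affinePart φ c ξ + ‖ξ - (2 : ℝ) • c‖ ^ 2 / 2)).indicator
        (fun τ => Real.exp (2 * l * affinePart φ c ξ) * Real.exp (-(2 * l) * τ)) := by
    intro ξ
    funext τ
    simp only [expAbove, indicator, mem_ofPred_eq, mem_Ici]
    split_ifs
    · rw [← Real.exp_nat_mul, ← Real.exp_add]
      congr 1
      push_cast
      ring
    · simp
  have hneg : -(2 * l) < 0 := by linarith
  have hint : ∀ ξ : Plane, Integrable (fun τ : ℝ => expAbove φ c l (ξ, τ) ^ 2) := by
    intro ξ
    rw [hfib, integrable_indicator_iff measurableSet_Ici]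
    exact ((integrableOn_Ici_iff_integrableOn_Ioi (by simp)).2
      (integrableOn_exp_mul_Ioi hneg _)).const_mul _
  have hval : ∀ ξ : Plane, ∫ τ : ℝ, expAbove φ c l (ξ, τ) ^ 2 =
      1 / (2 * l) * Real.exp (-l * ‖ξ - (2 : ℝ) • c‖ ^ 2) := by
    intro ξ
    rw [hfib, integral_indicator measurableSet_Ici, integral_const_mul, integral_Ici_eq_integral_Ioi,
      integral_exp_mul_Ioi hneg, neg_div_neg_eq, mul_div_assoc', ← Real.exp_add, div_eq_inv_mul,
      one_div]
    congr 2
    ring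
  have hI : Integrable (fun q => expAbove φ c l q ^ 2) := by
    rw [Measure.volume_eq_prod, integrable_prod_iff
      ((measurable_expAbove φ c l).pow_const 2).aestronglyMeasurable]
    refine ⟨ae_of_all _ hint, ?_⟩
    simp only [norm_pow, Real.norm_eq_abs, sq_abs]
    simp_rw [hval]
    exact (integrable_gaussian_plane hl _).const_mul _
  refine ⟨hI, ?_⟩
  rw [Measure.volume_eq_prod] at hI ⊢
  rw [integral_prod _ hI]
  simp_rw [hval]
  rw [integral_const_mul, integral_gaussian_plane hl]
  field_simp

/-- On the δ-ball `psiTangent` is at most (1 + ε)‖y - c‖². Subtracting a wider Gaussian of height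
exp(-l(1 + ε)δ²) makes the comparison function nonpositive off the ball, so it lies below the
integrand everywhere; the wider Gaussian has twice the integral, hence the factor 2. -/
theorem le_integral_exp_psiTangent {φ : Plane → ℝ} (hd : Differentiable ℝ φ)
    (hc : ConvexOn ℝ univ φ) {c : Plane} {ε δ : ℝ} (hε : 0 < ε) (hδ : 0 < δ)
    (hrem : ∀ y, ‖y - c‖ < δ → φ y - φ c - fderiv ℝ φ c (y - c) ≤ ε * ‖y - c‖ ^ 2)
    {l : ℝ} (hl : 0 < l) :
    Real.pi / (2 * l * (1 + ε)) * (1 - 2 * Real.exp (-(l * (1 + ε) * δ ^ 2))) ≤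
      ∫ y, ‖(Real.exp (-l * psiTangent φ c y) : ℂ)‖ ^ 2 := by
  have hb : 0 < 2 * l * (1 + ε) := by positivity
  have hb' : 0 < l * (1 + ε) := by positivity
  have h1 := integrable_gaussian_plane hb c
  have h2 := (integrable_gaussian_plane hb' c).const_mul (Real.exp (-(l * (1 + ε) * δ ^ 2)))
  have hI := (memLp_two_iff_integrable_sq_norm
    (memLp_exp_psiTangent hd hc c hl).aestronglyMeasurable).1 (memLp_exp_psiTangent hd hc c hl)
  calc _ = ∫ y, (Real.exp (-(2 * l * (1 + ε)) * ‖y - c‖ ^ 2) -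
        Real.exp (-(l * (1 + ε) * δ ^ 2)) * Real.exp (-(l * (1 + ε)) * ‖y - c‖ ^ 2)) := by
        rw [integral_sub h1 h2, integral_const_mul, integral_gaussian_plane hb,
          integral_gaussian_plane hb']
        field_simp
    _ ≤ _ := by
        refine integral_mono (h1.sub h2) hI fun y => ?_
        simp only [Complex.norm_real, Real.norm_eq_abs, Real.abs_exp]
        rw [← Real.exp_nat_mul]
        by_cases hy : ‖y - c‖ < δ
        · have h3 := hrem y hy
          have h4 : Real.exp (-(2 * l * (1 + ε)) * ‖y - c‖ ^ 2) ≤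
              Real.exp ((2 : ℕ) * (-l * psiTangent φ c y)) := by
            rw [Real.exp_le_exp]
            simp only [psiTangent]
            push_cast
            nlinarith
          have h5 : 0 ≤ Real.exp (-(l * (1 + ε) * δ ^ 2)) *
            Real.exp (-(l * (1 + ε)) * ‖y - c‖ ^ 2) := by positivity
          linarith
        · have h3 : δ ^ 2 ≤ ‖y - c‖ ^ 2 := pow_le_pow_left₀ hδ.le (not_lt.1 hy) 2
          have h4 : Real.exp (-(2 * l * (1 + ε)) * ‖y - c‖ ^ 2) ≤
              Real.exp (-(l * (1 + ε) * δ ^ 2)) * Real.exp (-(l * (1 + ε)) * ‖y - c‖ ^ 2) := by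
            rw [← Real.exp_add, Real.exp_le_exp]
            nlinarith
          have h5 := Real.exp_pos ((2 : ℕ) * (-l * psiTangent φ c y))
          linarith

/-- Take f = exp(-l · `psiTangent`) and G = `expAbove`, so that TG = f ⊗ f. Duality gives ‖f‖⁴ ≤
‖T*(f ⊗ f)‖ ‖G‖, and ‖G‖ = √(π/2)/l is explicit; the lower bound on ‖f‖² finishes. -/
theorem le_norm_surfaceDensity_exp {φ : Plane → ℝ} (hd : Differentiable ℝ φ)
    (hc : ConvexOn ℝ univ φ) {c : Plane} {ε δ : ℝ} (hε : 0 < ε) (hδ : 0 < δ)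
    (hrem : ∀ y, ‖y - c‖ < δ → φ y - φ c - fderiv ℝ φ c (y - c) ≤ ε * ‖y - c‖ ^ 2)
    {l : ℝ} (hl : 0 < l) :
    ∃ f : L2Plane, f ≠ 0 ∧
      √(Real.pi / 2) * ((1 - 2 * Real.exp (-(l * (1 + ε) * δ ^ 2))) / (1 + ε)) * ‖f‖ ^ 2 ≤
        ‖surfaceDensity hd hc (tensor f)‖ := by
  have hpi := Real.pi_pos
  have hmem := memLp_exp_psiTangent hd hc c hl
  set f : L2Plane := hmem.toLp with hf
  have hfc : f =ᵐ[volume] fun y => (Real.exp (-l * psiTangent φ c y) : ℂ) := hmem.coeFn_toLp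
  have hf0 : f ≠ 0 := by
    intro h0
    rw [h0] at hfc
    obtain ⟨y, hy⟩ := (hfc.symm.trans (Lp.coeFn_zero ℂ 2 volume)).exists
    exact Real.exp_ne_zero _ (Complex.ofReal_eq_zero.1 hy)
  have hfn : ‖f‖ ^ 2 = ∫ y, ‖(Real.exp (-l * psiTangent φ c y) : ℂ)‖ ^ 2 := by
    rw [Lp_norm_sq_eq_integral]
    refine integral_congr_ae ?_
    filter_upwards [hfc] with y hy
    rw [hy]
  have hI := le_integral_exp_psiTangent hd hc hε hδ hrem hl
  rw [← hfn] at hI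
  have hGm : MemLp (fun q => (expAbove φ c l q : ℂ)) 2 volume := by
    rw [memLp_two_iff_integrable_sq_norm]
    · refine (integral_expAbove_sq φ c hl).1.congr (ae_of_all _ fun q => ?_)
      simp [Complex.norm_real, sq_abs]
    · exact (Complex.measurable_ofReal.comp (measurable_expAbove φ c l)).aestronglyMeasurable
  set G : Lp ℂ 2 (volume : Measure (Plane × ℝ)) := hGm.toLp with hG
  have hGn : ‖G‖ ^ 2 = Real.pi / (2 * l ^ 2) := by
    rw [Lp_norm_sq_eq_integral, ← (integral_expAbove_sq φ c hl).2]
    refine integral_congr_ae ?_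
    filter_upwards [hGm.coeFn_toLp] with q hq
    rw [hG, hq]
    simp [Complex.norm_real, sq_abs]
  have hT : surfacePullback hd hc G = tensor f := by
    refine Lp.ext ?_
    have hS := (continuous_surfaceSum hd.continuous).measurable
    have h1 : ∀ᵐ p : Plane × Plane, f p.1 = (Real.exp (-l * psiTangent φ c p.1) : ℂ) :=
      Measure.quasiMeasurePreserving_fst.ae hfc
    have h2 : ∀ᵐ p : Plane × Plane, f p.2 = (Real.exp (-l * psiTangent φ c p.2) : ℂ) :=
      Measure.quasiMeasurePreserving_snd.ae hfc
    filter_upwards [h1, h2, coeFn_tensor f, coeFn_pullback hS ENNReal.ofReal_ne_top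
      (map_surfaceSum_le' hd hc) G, ae_eq_comp_of_map_le hS (map_surfaceSum_le' hd hc)
      hGm.coeFn_toLp] with p hp1 hp2 hp3 hp4 hp5
    rw [hp3, hp1, hp2, surfacePullback, hp4, hp5, Function.comp_apply, expAbove, indicator_of_mem]
    · rw [← Complex.ofReal_mul, ← Real.exp_add, surfaceSum, psi_add_psi_sub_affinePart]
      congr 2
      ring
    · have h3 := half_norm_sq_le_psiTangent hd hc c p.1 p.2
      have h4 := psi_add_psi_sub_affinePart φ c p.1 p.2
      rw [mem_ofPred_eq, surfaceSum]
      linarith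
  have hkey := norm_sq_le_norm_pushforward_mul
    (continuous_surfaceSum hd.continuous).measurable ENNReal.ofReal_ne_top
    (map_surfaceSum_le' hd hc) G
  change ‖surfacePullback hd hc G‖ ^ 2 ≤
    ‖surfaceDensity hd hc (surfacePullback hd hc G)‖ * ‖G‖ at hkey
  rw [hT, norm_tensor] at hkey
  have hGv : ‖G‖ = √(Real.pi / 2) / l := by
    rw [← Real.sqrt_sq (norm_nonneg G), hGn, ← Real.sqrt_sq hl.le, ← Real.sqrt_div' _ (by positivity),
      Real.sqrt_sq hl.le]
    congr 1
    field_simp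
  refine ⟨f, hf0, ?_⟩
  have hGpos : 0 < ‖G‖ := by rw [hGv]; positivity
  refine le_of_mul_le_mul_right (le_trans ?_ hkey) hGpos
  have hs : √(Real.pi / 2) * √(Real.pi / 2) = Real.pi / 2 := Real.mul_self_sqrt (by positivity)
  calc _ = (√(Real.pi / 2) * √(Real.pi / 2)) / (l * (1 + ε)) *
        (1 - 2 * Real.exp (-(l * (1 + ε) * δ ^ 2))) * ‖f‖ ^ 2 := by
        rw [hGv]; field_simp
    _ = Real.pi / (2 * l * (1 + ε)) * (1 - 2 * Real.exp (-(l * (1 + ε) * δ ^ 2))) *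
        ‖f‖ ^ 2 := by
        rw [hs]; field_simp
    -- Only one of the two factors ‖f‖² is replaced by its lower bound `hI`.
    _ ≤ ‖f‖ ^ 2 * ‖f‖ ^ 2 := by gcongr
    _ = (‖f‖ ^ 2) ^ 2 := by ring

theorem le_optConst_sq {φ : Plane → ℝ} {f : L2Plane} (hf : f ≠ 0) {s : ℝ}
    (hs : ENNReal.ofReal (s * ‖f‖ ^ 2) ≤ convNorm φ f f) :
    ENNReal.ofReal s ≤ optConst φ ^ 2 := by
  have h1 : convNorm φ f f ^ (1 / 2 : ℝ) / ‖f‖ₑ ≤ optConst φ :=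
    le_iSup₂ (f := fun (f : L2Plane) (_ : f ≠ 0) => convNorm φ f f ^ (1 / 2 : ℝ) / ‖f‖ₑ) f hf
  have h0 : ‖f‖ₑ ≠ 0 := enorm_ne_zero.2 hf
  have ht : ‖f‖ₑ ≠ ∞ := enorm_ne_top
  have h2 : convNorm φ f f ≤ optConst φ ^ 2 * ‖f‖ₑ ^ 2 := by
    have h3 := (ENNReal.div_le_iff h0 ht).1 h1
    have h4 := pow_le_pow_left' h3 2
    rw [← ENNReal.rpow_natCast, ← ENNReal.rpow_mul, mul_pow] at h4
    simpa using h4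
  have h5 : ENNReal.ofReal (s * ‖f‖ ^ 2) = ENNReal.ofReal s * ‖f‖ₑ ^ 2 := by
    rw [ENNReal.ofReal_mul' (by positivity), ENNReal.ofReal_pow (norm_nonneg _), ofReal_norm]
  have h6 := hs.trans h2
  rw [h5] at h6
  exact (ENNReal.mul_le_mul_iff_left (pow_ne_zero 2 h0) (ENNReal.pow_ne_top ht)).1 h6

/-- The point c and the radius δ depend on ε, so l → ∞ is taken first, concentrating the trial
functions at c, and ε → 0 afterwards. -/
theorem sqrt_half_pi_le_optConst_sq {φ : Plane → ℝ} (hφ : ContDiff ℝ 2 φ)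
    (hc : ConvexOn ℝ univ φ)
    (hH : (∃ y₀, hessian φ y₀ = 0) ∨
      (∃ y : ℕ → Plane, Tendsto (fun n => ‖y n‖) atTop atTop ∧
        Tendsto (fun n => hessian φ (y n)) atTop (𝓝 0))) :
    ENNReal.ofReal √(Real.pi / 2) ≤ optConst φ ^ 2 := by
  have hd : Differentiable ℝ φ := hφ.differentiable two_ne_zero
  have h1 : ∀ ε : ℝ, 0 < ε →
      ENNReal.ofReal (√(Real.pi / 2) * (1 / (1 + ε))) ≤ optConst φ ^ 2 := by
    intro ε hε
    obtain ⟨c, δ, hδ, hrem⟩ := exists_small_second_order_remainder hφ hH hε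
    have h2 : Tendsto (fun l : ℝ => ENNReal.ofReal (√(Real.pi / 2) *
        ((1 - 2 * Real.exp (-(l * (1 + ε) * δ ^ 2))) / (1 + ε)))) atTop
        (𝓝 (ENNReal.ofReal (√(Real.pi / 2) * ((1 - 2 * 0) / (1 + ε))))) := by
      refine ENNReal.tendsto_ofReal (Tendsto.const_mul _ (Tendsto.div_const
        (Tendsto.const_sub _ (Tendsto.const_mul _ ?_)) _))
      refine Real.tendsto_exp_neg_atTop_nhds_zero.comp ?_
      exact (tendsto_id.atTop_mul_const (by positivity)).atTop_mul_const (by positivity)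
    rw [mul_zero, sub_zero] at h2
    refine le_of_tendsto h2 ?_
    filter_upwards [eventually_gt_atTop 0] with l hl
    obtain ⟨f, hf0, hf⟩ := le_norm_surfaceDensity_exp hd hc hε hδ hrem hl
    refine le_optConst_sq hf0 ?_
    rw [convNorm_eq hd hc, ← ofReal_norm]
    exact ENNReal.ofReal_le_ofReal hf
  have h3 : Tendsto (fun ε : ℝ => ENNReal.ofReal (√(Real.pi / 2) * (1 / (1 + ε)))) (𝓝[>] 0)
      (𝓝 (ENNReal.ofReal (√(Real.pi / 2) * (1 / (1 + 0))))) := by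
    refine (ENNReal.tendsto_ofReal (Tendsto.const_mul _ (Tendsto.div tendsto_const_nhds
      (tendsto_id.const_add 1) (by norm_num)))).mono_left nhdsWithin_le_nhds
  have h4 := le_of_tendsto h3 (by filter_upwards [self_mem_nhdsWithin] with ε hε using h1 ε hε)
  simpa using h4

/-! ### Upper bound for split functions -/

/-- The squared `L²` mass of `f` on `A`. -/
noncomputable def mass (f : L2Plane) (A : Set Plane) : ℝ := ∫ x in A, ‖f x‖ ^ 2

theorem mass_nonneg (f : L2Plane) (A : Set Plane) : 0 ≤ mass f A :=
  integral_nonneg fun _ => by positivity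

theorem mass_univ (f : L2Plane) : mass f univ = ‖f‖ ^ 2 := by
  rw [mass, setIntegral_univ, Lp_norm_sq_eq_integral]

theorem integrable_norm_sq (f : L2Plane) : Integrable fun x => ‖f x‖ ^ 2 :=
  (memLp_two_iff_integrable_sq_norm (Lp.memLp f).aestronglyMeasurable).1 (Lp.memLp f)

theorem mass_le (f : L2Plane) (A : Set Plane) : mass f A ≤ ‖f‖ ^ 2 := by
  rw [← mass_univ]
  exact setIntegral_mono_set (integrable_norm_sq f).integrableOn
    (ae_of_all _ fun _ => by positivity) (subset_univ A).eventuallyLE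

theorem norm_sq_toLp_indicator {X : Type*} [MeasurableSpace X] {μ : Measure X} (u : Lp ℂ 2 μ)
    {A : Set X} (hA : MeasurableSet A) :
    ‖((Lp.memLp u).indicator hA).toLp‖ ^ 2 = ∫ x in A, ‖u x‖ ^ 2 ∂μ := by
  rw [Lp_norm_sq_eq_integral, ← integral_indicator hA]
  refine integral_congr_ae ?_
  filter_upwards [((Lp.memLp u).indicator hA).coeFn_toLp] with x hx
  rw [hx]
  by_cases hxA : x ∈ A <;> simp [hxA]

theorem normSq_indicator (f : L2Plane) {A : Set Plane} (hA : MeasurableSet A) :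
    normSq (A.indicator f) = mass f A := by
  rw [mass, ← norm_sq_toLp_indicator f hA, Lp.norm_toLp, normSq]

/-- The restriction of `f ⊗ f` to a set. -/
noncomputable def tensorOn (f : L2Plane) {P : Set (Plane × Plane)} (hP : MeasurableSet P) :
    Lp ℂ 2 (volume : Measure (Plane × Plane)) :=
  ((Lp.memLp (tensor f)).indicator hP).toLp

theorem coeFn_tensorOn (f : L2Plane) {P : Set (Plane × Plane)} (hP : MeasurableSet P) :
    tensorOn f hP =ᵐ[volume] P.indicator (tensor f) :=
  ((Lp.memLp (tensor f)).indicator hP).coeFn_toLp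

theorem norm_sq_tensorOn (f : L2Plane) {P : Set (Plane × Plane)} (hP : MeasurableSet P) :
    ‖tensorOn f hP‖ ^ 2 = ∫ p in P, ‖f p.1‖ ^ 2 * ‖f p.2‖ ^ 2 := by
  rw [tensorOn, norm_sq_toLp_indicator _ hP]
  refine integral_congr_ae (ae_restrict_of_ae ?_)
  filter_upwards [coeFn_tensor f] with p hp
  rw [hp, norm_mul, mul_pow]

theorem setIntegral_tensor_prod (f : L2Plane) (A B : Set Plane) :
    ∫ p in A ×ˢ B, ‖f p.1‖ ^ 2 * ‖f p.2‖ ^ 2 = mass f A * mass f B :=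
  setIntegral_prod_mul (fun x => ‖f x‖ ^ 2) (fun x => ‖f x‖ ^ 2) A B

theorem norm_tensorOn_prod (f : L2Plane) {A B : Set Plane} (hAB : MeasurableSet (A ×ˢ B)) :
    ‖tensorOn f hAB‖ = √(mass f A * mass f B) := by
  rw [← setIntegral_tensor_prod, ← norm_sq_tensorOn f hAB, Real.sqrt_sq (norm_nonneg _)]

/-- The blocks are disjoint, so their L² norms add in squares. This is the source of the strict
gain. -/
theorem norm_tensorOn_union (f : L2Plane) {A B : Set Plane} (hB : MeasurableSet B)
    (hd : Disjoint A B) (hP : MeasurableSet (A ×ˢ A ∪ B ×ˢ B)) :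
    ‖tensorOn f hP‖ = √(mass f A ^ 2 + mass f B ^ 2) := by
  have hint : Integrable fun p : Plane × Plane => ‖f p.1‖ ^ 2 * ‖f p.2‖ ^ 2 :=
    (integrable_norm_sq f).mul_prod (integrable_norm_sq f)
  rw [← Real.sqrt_sq (norm_nonneg (tensorOn f hP)), norm_sq_tensorOn,
    setIntegral_union (disjoint_prod.2 (Or.inl hd)) (hB.prod hB) hint.integrableOn
      hint.integrableOn, setIntegral_tensor_prod, setIntegral_tensor_prod, sq (mass f A),
    sq (mass f B)]

theorem norm_surfaceDensity_tensorOn_le {φ : Plane → ℝ} (hd : Differentiable ℝ φ)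
    (hc : ConvexOn ℝ univ φ) (f : L2Plane) {P : Set (Plane × Plane)} (hP : MeasurableSet P)
    {C : ℝ≥0∞} (hC : C ≠ ∞)
    (h : (volume.restrict P).map (surfaceSum φ) ≤ C • (volume : Measure (Plane × ℝ))) :
    ‖surfaceDensity hd hc (tensorOn f hP)‖ ≤ √C.toReal * ‖tensorOn f hP‖ := by
  refine norm_pushforward_le _ _ _ hP hC h _ ?_
  filter_upwards [coeFn_tensorOn f hP] with p hp hpP
  rw [hp, indicator_of_notMem hpP]

theorem norm_surfaceDensity_tensorOn_le' {φ : Plane → ℝ} (hd : Differentiable ℝ φ)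
    (hc : ConvexOn ℝ univ φ) (f : L2Plane) {P : Set (Plane × Plane)} (hP : MeasurableSet P) :
    ‖surfaceDensity hd hc (tensorOn f hP)‖ ≤ √(Real.pi / 2) * ‖tensorOn f hP‖ := by
  have := norm_surfaceDensity_tensorOn_le hd hc f hP ENNReal.ofReal_ne_top
    ((Measure.map_mono_of_aemeasurable Measure.restrict_le_self
      (continuous_surfaceSum hd.continuous).measurable.aemeasurable).trans
      (map_surfaceSum_le' hd hc))
  rwa [ENNReal.toReal_ofReal (by positivity)] at this

theorem map_surfaceSum_restrict_swap {φ : Plane → ℝ} (hφ : Continuous φ) {A B : Set Plane}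
    (hA : MeasurableSet A) (hB : MeasurableSet B) :
    (volume.restrict (B ×ˢ A)).map (surfaceSum φ) =
      (volume.restrict (A ×ˢ B)).map (surfaceSum φ) := by
  have hS := (continuous_surfaceSum hφ).measurable
  ext E hE
  rw [Measure.map_apply hS hE, Measure.map_apply hS hE, Measure.restrict_apply (hS hE),
    Measure.restrict_apply (hS hE),
    Measure.volume_eq_prod,
    ← (Measure.measurePreserving_swap (μ := (volume : Measure Plane))
      (ν := (volume : Measure Plane))).measure_preimage
      ((hS hE).inter (hA.prod hB)).nullMeasurableSet]
  congr 1
  ext p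
  simp only [mem_inter_iff, mem_preimage, surfaceSum, mem_prod, Prod.fst_swap, Prod.snd_swap,
    add_comm p.2 p.1, add_comm (psi φ p.2) (psi φ p.1), and_comm]

/-- The plane is cut into the ball A, the far region B and the remainder C. Pairs in A × B or B × A
are controlled by the sector constant, and pairs meeting C by the mass of C. -/
theorem norm_surfaceDensity_tensor_le {φ : Plane → ℝ} (hd : Differentiable ℝ φ)
    (hc : ConvexOn ℝ univ φ) (f : L2Plane) (hf : ‖f‖ ≤ 1) (c : Plane) {r R : ℝ} (hR : r < R) :
    ‖surfaceDensity hd hc (tensor f)‖ ≤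
      √(Real.pi / 2) * (√(mass f (Metric.ball c r) ^ 2 + mass f (Metric.ball c R)ᶜ ^ 2) +
        2 * √(mass f (Metric.ball c r ∪ (Metric.ball c R)ᶜ)ᶜ)) +
      2 * √(sectorConst (2 * r / (R - r))).toReal := by
  set A := Metric.ball c r with hA
  set B := (Metric.ball c R)ᶜ with hB
  set C := (A ∪ B)ᶜ with hC
  have hAm : MeasurableSet A := Metric.isOpen_ball.measurableSet
  have hBm : MeasurableSet B := Metric.isOpen_ball.measurableSet.compl
  have hCm : MeasurableSet C := (hAm.union hBm).compl
  have hdisj : Disjoint A B := disjoint_compl_right_iff_subset.2 (Metric.ball_subset_ball hR.le)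
  have hf2 : ‖f‖ ^ 2 ≤ 1 := pow_le_one₀ (norm_nonneg _) hf
  have hm1 : ∀ s, mass f s ≤ 1 := fun s => (mass_le f s).trans hf2
  -- The two diagonal blocks are kept as one piece: estimated separately they would give `mass f A`
  -- + `mass f B`, which may equal 1 and gains nothing.
  have h1 := (hAm.prod hAm).union (hBm.prod hBm)
  have h2 := hAm.prod hBm
  have h3 := hBm.prod hAm
  have h4 : MeasurableSet (C ×ˢ (univ : Set Plane)) := hCm.prod MeasurableSet.univ
  have h5 := hCm.compl.prod hCm
  have hsum : tensor f = tensorOn f h1 + tensorOn f h2 + tensorOn f h3 + tensorOn f h4 +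
      tensorOn f h5 := by
    refine Lp.ext ?_
    filter_upwards [coeFn_tensorOn f h1, coeFn_tensorOn f h2, coeFn_tensorOn f h3,
      coeFn_tensorOn f h4, coeFn_tensorOn f h5,
      Lp.coeFn_add (tensorOn f h1 + tensorOn f h2 + tensorOn f h3 + tensorOn f h4) (tensorOn f h5),
      Lp.coeFn_add (tensorOn f h1 + tensorOn f h2 + tensorOn f h3) (tensorOn f h4),
      Lp.coeFn_add (tensorOn f h1 + tensorOn f h2) (tensorOn f h3),
      Lp.coeFn_add (tensorOn f h1) (tensorOn f h2)] with p e1 e2 e3 e4 e5 e6 e7 e8 e9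
    rw [e6, Pi.add_apply, e7, Pi.add_apply, e8, Pi.add_apply, e9, Pi.add_apply, e1, e2, e3, e4, e5]
    have hx : ∀ x, x ∈ A → x ∉ B := fun x hxA hxB => disjoint_left.1 hdisj hxA hxB
    have hmem : ∀ x, x ∈ C ↔ x ∉ A ∧ x ∉ B := fun x => by
      rw [hC, mem_compl_iff, mem_union, not_or]
    clear_value A B C
    by_cases a1 : p.1 ∈ A <;> by_cases b1 : p.1 ∈ B <;> by_cases a2 : p.2 ∈ A <;>
      by_cases b2 : p.2 ∈ B <;> first
      | exact absurd b1 (hx _ a1)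
      | exact absurd b2 (hx _ a2)
      | simp [indicator, hmem, a1, b1, a2, b2]
  have hsep := map_surfaceSum_separated_le hd hc hR h2 subset_rfl
  have n1 := norm_surfaceDensity_tensorOn_le' hd hc f h1
  have n2 := norm_surfaceDensity_tensorOn_le hd hc f h2 (sectorConst_ne_top _) hsep
  have n3 := norm_surfaceDensity_tensorOn_le hd hc f h3 (sectorConst_ne_top _)
    ((map_surfaceSum_restrict_swap hd.continuous hAm hBm).le.trans hsep)
  have n4 := norm_surfaceDensity_tensorOn_le' hd hc f h4
  have n5 := norm_surfaceDensity_tensorOn_le' hd hc f h5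
  rw [norm_tensorOn_union f hBm hdisj h1] at n1
  have m2 : ‖tensorOn f h2‖ ≤ 1 := by
    rw [norm_tensorOn_prod]
    exact Real.sqrt_le_one.2 (mul_le_one₀ (hm1 _) (mass_nonneg _ _) (hm1 _))
  have m3 : ‖tensorOn f h3‖ ≤ 1 := by
    rw [norm_tensorOn_prod]
    exact Real.sqrt_le_one.2 (mul_le_one₀ (hm1 _) (mass_nonneg _ _) (hm1 _))
  have m4 : ‖tensorOn f h4‖ ≤ √(mass f C) := by
    rw [norm_tensorOn_prod]
    exact Real.sqrt_le_sqrt (mul_le_of_le_one_right (mass_nonneg _ _) (hm1 _))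
  have m5 : ‖tensorOn f h5‖ ≤ √(mass f C) := by
    rw [norm_tensorOn_prod]
    exact Real.sqrt_le_sqrt (mul_le_of_le_one_left (mass_nonneg _ _) (hm1 _))
  have k2 := mul_le_mul_of_nonneg_left m2
    (Real.sqrt_nonneg (sectorConst (2 * r / (R - r))).toReal)
  have k3 := mul_le_mul_of_nonneg_left m3
    (Real.sqrt_nonneg (sectorConst (2 * r / (R - r))).toReal)
  have k4 := mul_le_mul_of_nonneg_left m4 (Real.sqrt_nonneg (Real.pi / 2))
  have k5 := mul_le_mul_of_nonneg_left m5 (Real.sqrt_nonneg (Real.pi / 2))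
  rw [hsum, map_add, map_add, map_add, map_add]
  set D := surfaceDensity hd hc
  have t1 := norm_add_le (D (tensorOn f h1) + D (tensorOn f h2) + D (tensorOn f h3) +
    D (tensorOn f h4)) (D (tensorOn f h5))
  have t2 := norm_add_le (D (tensorOn f h1) + D (tensorOn f h2) + D (tensorOn f h3))
    (D (tensorOn f h4))
  have t3 := norm_add_le (D (tensorOn f h1) + D (tensorOn f h2)) (D (tensorOn f h3))
  have t4 := norm_add_le (D (tensorOn f h1)) (D (tensorOn f h2))
  linarith

theorem normSq_sub_indicators (f : L2Plane) {A B : Set Plane} (hA : MeasurableSet A)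
    (hB : MeasurableSet B) (hd : Disjoint A B) :
    normSq (fun x => f x - (A.indicator f x + B.indicator f x)) = mass f (A ∪ B)ᶜ := by
  rw [← normSq_indicator f (hA.union hB).compl]
  congr 1
  funext x
  have hx : x ∈ A → x ∉ B := fun hxA hxB => disjoint_left.1 hd hxA hxB
  by_cases a : x ∈ A <;> by_cases b : x ∈ B <;> first
    | exact absurd b (hx a)
    | simp [a, b]

theorem tendsto_sectorConst_of_tendsto_atTop {r : ℝ} (hr : 0 < r) {R : ℕ → ℝ}
    (hR : Tendsto R atTop atTop) :
    Tendsto (fun n => √(sectorConst (2 * r / (R n - r))).toReal) atTop (𝓝 0) := by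
  have h1 : Tendsto (fun n => R n - r) atTop atTop := tendsto_atTop_add_const_right _ (-r) hR
  have h2 : Tendsto (fun n => 2 * r / (R n - r)) atTop (𝓝[>] 0) := by
    refine tendsto_nhdsWithin_iff.2 ⟨h1.const_div_atTop _, ?_⟩
    filter_upwards [h1.eventually_gt_atTop 0] with n hn
    exact div_pos (by positivity) hn
  have h3 := (ENNReal.tendsto_toReal ENNReal.zero_ne_top).comp (tendsto_sectorConst.comp h2)
  have h4 := (Real.continuous_sqrt.tendsto _).comp h3
  rwa [ENNReal.toReal_zero, Real.sqrt_zero] at h4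

end PerturbedParaboloid

open PerturbedParaboloid

/-! ### Splitting contradicts the lower bound -/

theorem proposition5p7 (φ : PerturbedParaboloid.Plane → ℝ)
    (hφ_nonneg : ∀ y, 0 ≤ φ y)
    (hφ_smooth : ContDiff ℝ 2 φ)
    (hφ_convex : StrictConvexOn ℝ Set.univ φ)
    (hφ_hessian :
      (∃ y₀, PerturbedParaboloid.hessian φ y₀ = 0) ∨
      (∃ y : ℕ → PerturbedParaboloid.Plane,
        Tendsto (fun n => ‖y n‖) atTop atTop ∧
        Tendsto (fun n => PerturbedParaboloid.hessian φ (y n)) atTop (𝓝 0)))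
    (f : ℕ → PerturbedParaboloid.L2Plane)
    (hf : PerturbedParaboloid.IsExtremizingSeq φ f) :
    ¬ PerturbedParaboloid.SplittingCondition f := by
  rintro ⟨α, hα0, hα1, hsplit⟩
  have hd : Differentiable ℝ φ := hφ_smooth.differentiable two_ne_zero
  have hc := hφ_convex.convexOn
  have hlow := sqrt_half_pi_le_optConst_sq hφ_smooth hc hφ_hessian
  have hpos : 0 < √(Real.pi / 2) := Real.sqrt_pos.2 (by have := Real.pi_pos; positivity)
  -- The radius r, the centres and R depend on ε, so n → ∞ is taken with ε fixed, which removes the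
  -- sector term; ε → 0 comes last.
  have hε : ∀ ε : ℝ, 0 < ε →
      √(Real.pi / 2) ≤ √(Real.pi / 2) * (√((α + ε) ^ 2 + (1 - α + ε) ^ 2) + 2 * √ε) := by
    intro ε hε
    obtain ⟨r, n₀, y, R, hr, hR, h⟩ := hsplit ε hε
    have hup : ∀ᶠ n in atTop, convNorm φ (f n) (f n) ≤
        ENNReal.ofReal (√(Real.pi / 2) * (√((α + ε) ^ 2 + (1 - α + ε) ^ 2) + 2 * √ε) +
          2 * √(sectorConst (2 * r / (R n - r))).toReal) := by
      filter_upwards [eventually_ge_atTop n₀, hR.eventually_gt_atTop r] with n hn hRn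
      obtain ⟨e1, e2, e3⟩ := h n hn
      have hAm : MeasurableSet (Metric.ball (y n) r) := Metric.isOpen_ball.measurableSet
      have hBm : MeasurableSet (Metric.ball (y n) (R n))ᶜ := Metric.isOpen_ball.measurableSet.compl
      rw [normSq_sub_indicators (f n) hAm hBm
        (Set.disjoint_compl_right_iff_subset.2 (Metric.ball_subset_ball hRn.le))] at e1
      rw [normSq_indicator (f n) hAm] at e2
      rw [normSq_indicator (f n) hBm] at e3
      rw [convNorm_eq hd hc, ← ofReal_norm]
      refine ENNReal.ofReal_le_ofReal ((norm_surfaceDensity_tensor_le hd hc (f n) (hf.1 n) (y n)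
        hRn).trans ?_)
      have a2 := (abs_le.1 e2).2
      have a3 := (abs_le.1 e3).2
      gcongr
      · exact mass_nonneg _ _
      · linarith
      · exact mass_nonneg _ _
      · linarith
    have hlim := ENNReal.tendsto_ofReal (((tendsto_sectorConst_of_tendsto_atTop hr hR).const_mul
      2).const_add (√(Real.pi / 2) * (√((α + ε) ^ 2 + (1 - α + ε) ^ 2) + 2 * √ε)))
    have hle := hlow.trans (le_of_tendsto_of_tendsto hf.2 hlim hup)
    rw [mul_zero, add_zero] at hle
    exact (ENNReal.ofReal_le_ofReal_iff (by positivity)).1 hle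
  have hlim : Tendsto (fun ε : ℝ =>
      √(Real.pi / 2) * (√((α + ε) ^ 2 + (1 - α + ε) ^ 2) + 2 * √ε)) (𝓝[>] 0)
      (𝓝 (√(Real.pi / 2) * (√((α + 0) ^ 2 + (1 - α + 0) ^ 2) + 2 * √0))) :=
    (Continuous.tendsto (by fun_prop) 0).mono_left nhdsWithin_le_nhds
  have hfin := ge_of_tendsto hlim
    (by filter_upwards [self_mem_nhdsWithin] with ε h using hε ε h)
  rw [Real.sqrt_zero, mul_zero, add_zero, add_zero, add_zero] at hfin
  -- Equivalent to 2α(1 - α) > 0, which is where 0 < α < 1 enters.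
  have h1 : √(α ^ 2 + (1 - α) ^ 2) < 1 := by
    rw [Real.sqrt_lt' one_pos]
    nlinarith
  nlinarith
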